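/- Let $n\ge 1$. For $f:\mathbb Z^n\to\mathbb R$ let the discrete strong maximal operator be \[ \tilde M_S f(m)=\sup_{0\in R}\ \frac{1}{\#(R\cap\mathbb Z^n)}\sum_{j\in R\cap\mathbb Z^n}|f(m+j)|,\qquad m\in\mathbb Z^n, \] where the supremum is over all bounded open rectangles $R\subset\mathbb R^n$ with sides parallel to the coordinate axes that contain the origin. For $0<\alpha<1$ let its Tauberian constant be \[ \tilde C_S(\alpha)=\sup_{\substack{E\subset\mathbb Z^n\\ 0<\#E<\infty}}\ \frac{1}{\#E}\,\#\{m\in\mathbb Z^n:\ \tilde M_S\chi_E(m)>\alpha\}. \] (i) If $n\ge 2$, then $\tilde C_S\in C^{1/n}(0,1)$; that is, $\tilde C_S(\alpha)<\infty$ for every $\alpha\in(0,1)$, and for every compact set $K\subset(0,1)$ there is a constant $c$ (depending on $n$ and $K$) such that $|\tilde C_S(\alpha)-\tilde C_S(\beta)|\le c\,|\alpha-\beta|^{1/n}$ for all $\alpha,\beta\in K$. (ii) If $n=1$, then $\tilde C_S(\alpha)=\frac{2}{\alpha}-1$ for all $\alpha\in(0,1)$, and $\tilde C_S\in C^\infty(0,1)$.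 -/

import Mathlib

open Set
open scoped ENNReal NNReal ContDiff

noncomputable section

namespace StrongMaximal

/-- Bounded open rectangles in `ℝⁿ` with sides parallel to the coordinate axes. -/
def IsOpenRect {n : ℕ} (R : Set (Fin n → ℝ)) : Prop :=
  ∃ a b : Fin n → ℝ, R = Set.univ.pi fun i => Set.Ioo (a i) (b i)

/-- The set `R ∩ ℤⁿ`, as a set of lattice points. -/
def latticePoints {n : ℕ} (R : Set (Fin n → ℝ)) : Set (Fin n → ℤ) :=
  {j | (fun i => (j i : ℝ)) ∈ R}

/-- The discrete strong maximal operator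
`M̃_S f(m) = sup_{0 ∈ R} #(R ∩ ℤⁿ)⁻¹ ∑_{j ∈ R ∩ ℤⁿ} |f(m + j)|`, with values in `[0, ∞]`, the
supremum being over all open axis-parallel rectangles `R ⊆ ℝⁿ` containing the origin. -/
def discreteStrongMaximal {n : ℕ} (f : (Fin n → ℤ) → ℝ) (m : Fin n → ℤ) : ℝ≥0∞ :=
  ⨆ (R : Set (Fin n → ℝ)) (_ : IsOpenRect R) (_ : (0 : Fin n → ℝ) ∈ R),
    (∑' j : latticePoints R, ENNReal.ofReal |f (m + j)|) / ((latticePoints R).encard : ℝ≥0∞)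

/-- The halo `{m ∈ ℤⁿ : M̃_S χ_E(m) > α}`. -/
def discreteHalo {n : ℕ} (α : ℝ) (E : Set (Fin n → ℤ)) : Set (Fin n → ℤ) :=
  {m | ENNReal.ofReal α < discreteStrongMaximal (E.indicator fun _ => (1 : ℝ)) m}

/-- The Tauberian constant `C̃_S(α)` of the discrete strong maximal operator on `ℤⁿ`, as an element
of `[0, ∞]`: the supremum of `#{M̃_S χ_E > α} / #E` over all finite non-empty `E ⊆ ℤⁿ`. -/
def discreteTauberian (n : ℕ) (α : ℝ) : ℝ≥0∞ :=
  ⨆ (E : Set (Fin n → ℤ)) (_ : E.Nonempty) (_ : E.Finite),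
    ((discreteHalo α E).encard : ℝ≥0∞) / (E.encard : ℝ≥0∞)

/-- The (local) Hölder class `C^r(U)`: Hölder continuity of order `r` on every compact subset
of `U`, with a constant that may depend on the compact set. -/
def MemHolderClass (r : ℝ≥0) (f : ℝ → ℝ) (U : Set ℝ) : Prop :=
  ∀ K : Set ℝ, IsCompact K → K ⊆ U → ∃ c : ℝ≥0, HolderOnWith c r f K

end StrongMaximal

end

/-! Write c(α) for the Tauberian constant; it decreases in α. Two facts give the Hölder bound. Near
level 1: c(1 - ηⁿ) ≤ (2/(1-η) - 1)ⁿ = 1 + O(η). Take one-dimensional halos at level 1 - η in each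
coordinate direction in turn. Each costs the sharp one-dimensional factor 2/(1-η) - 1
(`card_le_of_subset_lineHalo`), and the last one contains every box of density above 1 - ηⁿ
(`box_subset_of_lineHalo_subset`). Submultiplicativity: c(α) ≤ c(1-ε) c(β) when β - α is at most a
multiple of ε α(1-β) (`HaloBound.mul`). If E has density between α and β in a box, its indicator has
variance there, so by Efron–Stein it has variance along lines. On each such line the halo of level 1
- ε gains in proportion to the variance, which lifts the density in the box above β. The loss of one
lattice point at the end of a run is absorbed by first dilating E, which does not change densities
in boxes. With ε = ηⁿ proportional to β - α, these give c(α) - c(β) = O(η) = O((β-α)^{1/n}). For n =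
1 the first fact with η = 1 - α is already sharp, as intervals show. -/

namespace StrongMaximal

/-! ### Intervals in ℤ -/

/-- From a finite family of integer intervals one can extract a subfamily with the same union
such that no point lies in more than two of its members. -/
theorem exists_subfamily_overlap_le_two (J : Finset (ℤ × ℤ)) :
    ∃ J' ⊆ J, (∀ x : ℤ, (∃ I ∈ J, x ∈ Finset.Ico I.1 I.2) → ∃ I ∈ J', x ∈ Finset.Ico I.1 I.2) ∧
      ∀ x : ℤ, (J'.filter fun I => x ∈ Finset.Ico I.1 I.2).card ≤ 2 := by
  induction J using Finset.strongInduction with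
  | H J ih =>
  by_cases h : ∀ x : ℤ, (J.filter fun I => x ∈ Finset.Ico I.1 I.2).card ≤ 2
  · exact ⟨J, Finset.Subset.refl _, fun _ h => h, h⟩
  push Not at h
  obtain ⟨x, hx⟩ := h
  set T := J.filter fun I => x ∈ Finset.Ico I.1 I.2 with hT
  have hTne : T.Nonempty := Finset.card_pos.1 (by omega)
  -- Among the intervals through x, the one reaching furthest left and the one reaching furthest
  -- right together cover all the others, so any third one is redundant.
  obtain ⟨A, hA, hAmin⟩ := Finset.exists_min_image T (fun I => I.1) hTne
  obtain ⟨B, hB, hBmax⟩ := Finset.exists_max_image T (fun I => I.2) hTne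
  have : ∃ I ∈ T, I ∉ ({A, B} : Finset (ℤ × ℤ)) := by
    by_contra hcon
    push Not at hcon
    have := (Finset.card_le_card (show T ⊆ {A, B} from hcon)).trans Finset.card_le_two
    omega
  obtain ⟨I, hI, hIAB⟩ := this
  simp only [Finset.mem_insert, Finset.mem_singleton, not_or] at hIAB
  have hmem : ∀ I ∈ T, I ∈ J ∧ I.1 ≤ x ∧ x < I.2 := by
    intro I hI
    simpa [hT] using hI
  obtain ⟨J', hJ', hcov, hov⟩ := ih (J.erase I) (Finset.erase_ssubset (hmem I hI).1)
  refine ⟨J', hJ'.trans (Finset.erase_subset _ _), fun y hy => hcov y ?_, hov⟩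
  obtain ⟨I', hI', hy⟩ := hy
  by_cases hII : I' = I
  · subst hII
    rw [Finset.mem_Ico] at hy
    have h1 := hAmin _ hI
    have h2 := hBmax _ hI
    rcases le_total y x with hyx | hyx
    · exact ⟨A, Finset.mem_erase.2 ⟨fun h => hIAB.1 h.symm, (hmem A hA).1⟩,
        Finset.mem_Ico.2 ⟨h1.trans hy.1, hyx.trans_lt (hmem A hA).2.2⟩⟩
    · exact ⟨B, Finset.mem_erase.2 ⟨fun h => hIAB.2 h.symm, (hmem B hB).1⟩,
        Finset.mem_Ico.2 ⟨(hmem B hB).2.1.trans hyx, hy.2.trans_le h2⟩⟩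
  · exact ⟨I', Finset.mem_erase.2 ⟨hII, hI'⟩, hy⟩

/-- The sharp weak type bound for the uncentred maximal function on `ℤ`. -/
theorem card_le_of_dense_intervals {s : ℝ} (hs : 0 < s) (hs1 : s ≤ 1) (S G : Finset ℤ)
    (h : ∀ x ∈ G, ∃ u v : ℤ, x ∈ Finset.Ico u v ∧
      s * ((Finset.Ico u v).card : ℝ) < ((S ∩ Finset.Ico u v).card : ℝ)) :
    (G.card : ℝ) ≤ (2 / s - 1) * S.card := by
  classical
  choose! u v huv hd using h
  obtain ⟨J, hJ, hcov, hov⟩ := exists_subfamily_overlap_le_two (G.image fun x => (u x, v x))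
  set U := J.biUnion fun I => Finset.Ico I.1 I.2 with hU
  set m : ℤ → ℝ := fun x => ((J.filter fun I => x ∈ Finset.Ico I.1 I.2).card : ℝ) with hm
  have hGU : G ⊆ U := by
    intro x hx
    obtain ⟨I, hI, hxI⟩ := hcov x ⟨_, Finset.mem_image_of_mem _ hx, huv x hx⟩
    exact Finset.mem_biUnion.2 ⟨I, hI, hxI⟩
  have hm1 : ∀ x ∈ U, 1 ≤ m x := by
    intro x hx
    obtain ⟨I, hI, hxI⟩ := Finset.mem_biUnion.1 hx
    have : 0 < (J.filter fun I => x ∈ Finset.Ico I.1 I.2).card :=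
      Finset.card_pos.2 ⟨I, Finset.mem_filter.2 ⟨hI, hxI⟩⟩
    simp only [hm]
    exact_mod_cast this
  have hm2 : ∀ x, m x ≤ 2 := fun x => by
    simp only [hm]
    exact_mod_cast hov x
  have hswap : ∀ W : Finset ℤ, ∑ x ∈ W, m x = ∑ I ∈ J, ((W ∩ Finset.Ico I.1 I.2).card : ℝ) := by
    intro W
    simp only [hm, Finset.card_filter, ← Finset.filter_mem_eq_inter]
    push_cast
    rw [Finset.sum_comm]
  have hkey : s * ∑ x ∈ U, m x ≤ ∑ x ∈ S, m x := by
    rw [hswap, hswap, Finset.mul_sum]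
    refine Finset.sum_le_sum fun I hI => ?_
    obtain ⟨x, hx, rfl⟩ := Finset.mem_image.1 (hJ hI)
    have : U ∩ Finset.Ico (u x) (v x) = Finset.Ico (u x) (v x) :=
      Finset.inter_eq_right.2 fun y hy => Finset.mem_biUnion.2 ⟨_, hI, hy⟩
    simp only [this]
    exact (hd x hx).le
  have hSout : ∑ x ∈ S, m x = ∑ x ∈ S ∩ U, m x := by
    refine (Finset.sum_subset Finset.inter_subset_left fun x hx hxU => ?_).symm
    simp only [hm, Nat.cast_eq_zero, Finset.card_eq_zero, Finset.filter_eq_empty_iff]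
    exact fun I hI hxI => hxU (Finset.mem_inter.2 ⟨hx, Finset.mem_biUnion.2 ⟨I, hI, hxI⟩⟩)
  -- Tracking the excess m - 1 on both sides of `hkey`, instead of only using m ≤ 2, is what
  -- improves the constant from 2/s to 2/s - 1.
  have hA : ∑ x ∈ S ∩ U, (m x - 1) ≤ (S ∩ U).card := by
    have := Finset.sum_le_card_nsmul (S ∩ U) (fun x => m x - 1) 1 fun x _ => by linarith [hm2 x]
    simpa using this
  have hB : ∑ x ∈ S ∩ U, (m x - 1) ≤ ∑ x ∈ U, (m x - 1) :=
    Finset.sum_le_sum_of_subset_of_nonneg Finset.inter_subset_right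
      fun x hx _ => by linarith [hm1 x hx]
  rw [Finset.sum_sub_distrib] at hA hB
  rw [Finset.sum_sub_distrib] at hB
  simp only [Finset.sum_const, nsmul_eq_mul, mul_one] at hA hB
  have hc1 : (G.card : ℝ) ≤ U.card := by exact_mod_cast Finset.card_le_card hGU
  have hc2 : ((S ∩ U).card : ℝ) ≤ S.card := by
    exact_mod_cast Finset.card_le_card Finset.inter_subset_left
  have : s * G.card ≤ (2 - s) * S.card := by
    rw [hSout] at hkey
    have e1 : s * G.card ≤ s * U.card := by gcongr
    nlinarith
  rw [div_sub_one hs.ne', div_mul_eq_mul_div, le_div_iff₀ hs]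
  linarith

/-- If a function has nonpositive sum over each maximal run of consecutive integers in `A`, then
it has nonpositive sum over `A`. -/
theorem sum_nonpos_of_runs (A : Finset ℤ) (w : ℤ → ℝ)
    (h : ∀ a b : ℤ, a < b → Finset.Ico a b ⊆ A → a - 1 ∉ A → b ∉ A →
      ∑ x ∈ Finset.Ico a b, w x ≤ 0) :
    ∑ x ∈ A, w x ≤ 0 := by
  induction A using Finset.strongInduction with
  | H A ih =>
  rcases A.eq_empty_or_nonempty with rfl | hne
  · simp
  set a := A.min' hne with ha
  have haA : a ∈ A := A.min'_mem hne
  have hmin : ∀ x ∈ A, a ≤ x := fun x hx => A.min'_le x hx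
  have hex : ∃ k : ℕ, a + k ∉ A := by
    by_contra hcon
    push Not at hcon
    exact (Set.infinite_of_injective_forall_mem (f := fun k : ℕ => a + (k : ℤ))
      (fun x y hxy => by simpa using hxy) hcon) A.finite_toSet
  classical
  set k := Nat.find hex with hk
  have hkn : a + k ∉ A := Nat.find_spec hex
  have hkmin : ∀ j : ℕ, j < k → a + j ∈ A := fun j hj => not_not.1 (Nat.find_min hex hj)
  have hkpos : 0 < k := by
    rcases Nat.eq_zero_or_pos k with h0 | h0
    · rw [h0] at hkn
      simp [haA] at hkn
    · exact h0
  have hsub : Finset.Ico a (a + k) ⊆ A := by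
    intro x hx
    rw [Finset.mem_Ico] at hx
    have := hkmin (x - a).toNat (by omega)
    rwa [Int.toNat_of_nonneg (by omega), add_sub_cancel] at this
  have hrun := h a (a + k) (by omega) hsub (fun h' => by linarith [hmin _ h']) hkn
  rw [← Finset.sum_sdiff hsub]
  refine add_nonpos (ih _ (Finset.sdiff_ssubset hsub ⟨a, by simp [hkpos]⟩) ?_) hrun
  intro a' b' hab hsub' ha' hb'
  -- The gap at a + k separates the first run from the rest, so the maximal runs of the rest are
  -- maximal runs of A.
  have hlow : ∀ x ∈ A \ Finset.Ico a (a + k), a + k < x := by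
    intro x hx
    rw [Finset.mem_sdiff, Finset.mem_Ico] at hx
    have h1 := hmin x hx.1
    have h2 : x ≠ a + k := fun h' => hkn (h' ▸ hx.1)
    omega
  have h1 := hlow a' (hsub' (by simp [hab]))
  refine h a' b' hab (hsub'.trans Finset.sdiff_subset) (fun h' => ha' ?_) (fun h' => hb' ?_)
  · rw [Finset.mem_sdiff, Finset.mem_Ico]
    exact ⟨h', by omega⟩
  · rw [Finset.mem_sdiff, Finset.mem_Ico]
    exact ⟨h', by omega⟩

/-- One-dimensional growth of a union `S` of long blocks: a set `F` containing every interval in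
which `S` has density more than `γ` is everything or larger than `S` by almost the
factor `γ⁻¹`. -/
theorem eq_or_card_le_of_blocks {γ : ℝ} (hγ : 0 < γ) {N : ℕ} (hN : 0 < N) {p q : ℤ}
    {S F : Finset ℤ} (hFI : F ⊆ Finset.Ico p q) (hSF : S ⊆ F)
    (hS : ∀ t ∈ S, ∀ t' : ℤ, t' / N = t / N → t' ∈ S)
    (hF : ∀ u v : ℤ, p ≤ u → v ≤ q →
      γ * ((Finset.Ico u v).card : ℝ) < ((S ∩ Finset.Ico u v).card : ℝ) → Finset.Ico u v ⊆ F) :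
    F = Finset.Ico p q ∨ (S.card : ℝ) ≤ γ * (1 + 1 / N) * F.card := by
  classical
  by_cases hfull : F = Finset.Ico p q
  · exact Or.inl hfull
  right
  have hN' : (0 : ℝ) < N := by exact_mod_cast hN
  have hc : 0 < γ * (1 + 1 / N) := by positivity
  -- It suffices to compare S with F on each maximal run of F.
  have key := sum_nonpos_of_runs F (fun t => (if t ∈ S then (1 : ℝ) else 0) - γ * (1 + 1 / N)) ?_
  · rw [Finset.sum_sub_distrib, Finset.sum_const, nsmul_eq_mul, Finset.sum_boole,
      Finset.filter_mem_eq_inter, Finset.inter_eq_right.2 hSF] at key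
    linarith
  intro a b hab hsub ha hb
  rw [Finset.sum_sub_distrib, Finset.sum_const, nsmul_eq_mul, Finset.sum_boole,
    Finset.filter_mem_eq_inter, Finset.inter_comm]
  have hpa := Finset.mem_Ico.1 (hFI (hsub (Finset.left_mem_Ico.2 hab)))
  have hbq := Finset.mem_Ico.1 (hFI (hsub (Finset.mem_Ico.2 ⟨by omega, by omega⟩ : b - 1 ∈ _)))
  have hcard : ((Finset.Ico a b).card : ℝ) = b - a := by
    rw [Int.card_Ico, ← Int.cast_natCast, Int.toNat_of_nonneg (by omega)]
    push_cast
    ring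
  have hab' : (a : ℝ) < b := by exact_mod_cast hab
  rcases (S ∩ Finset.Ico a b).eq_empty_or_nonempty with hemp | ⟨t, ht⟩
  · rw [hemp, hcard]
    simp only [Finset.card_empty, Nat.cast_zero, zero_sub, neg_nonpos]
    exact mul_nonneg (by linarith) hc.le
  rw [Finset.mem_inter, Finset.mem_Ico] at ht
  have hNz : (0 : ℤ) < N := by exact_mod_cast hN
  have hblock : ∀ t', (t / N) * N ≤ t' → t' < (t / N) * N + N → t' ∈ F := by
    intro t' h1 h2
    refine hSF (hS t ht.1 t' ?_)
    apply le_antisymm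
    · exact Int.lt_add_one_iff.1 (Int.ediv_lt_of_lt_mul hNz (by linarith))
    · exact (Int.le_ediv_iff_mul_le hNz).2 h1
  have ht1 := Int.ediv_mul_le t hNz.ne'
  have ht2 := Int.lt_ediv_add_one_mul_self t hNz
  -- A run that meets S contains a whole block of S, so one extra point lengthens it by a factor of
  -- at most 1 + 1/N.
  have hlen : (N : ℤ) ≤ b - a := by
    have h1 : a ≤ t / N * N := by
      by_contra hcon
      exact ha (hblock _ (by omega) (by linarith))
    have h2 : t / N * N + N ≤ b := by
      by_contra hcon
      exact hb (hblock _ (by linarith) (by omega))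
    omega
  have hlen' : (N : ℝ) ≤ b - a := by exact_mod_cast hlen
  -- As F is not all of [p, q), the run can be enlarged by one point without leaving [p, q). By
  -- maximality the enlarged interval is not inside F, so S has density at most γ in it.
  have hbound : ((S ∩ Finset.Ico a b).card : ℝ) ≤ γ * (b - a + 1) := by
    by_cases hbq' : b = q
    · have hap : p < a := by
        rcases hpa.1.lt_or_eq with h | h
        · exact h
        · exact absurd (Finset.Subset.antisymm hFI (by rw [h, ← hbq']; exact hsub)) hfull
      by_contra hcon
      push Not at hcon
      refine ha (hF (a - 1) b (by omega) (by omega) ?_ (Finset.left_mem_Ico.2 (by omega)))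
      have : ((Finset.Ico (a - 1) b).card : ℝ) = b - a + 1 := by
        rw [Int.card_Ico, ← Int.cast_natCast, Int.toNat_of_nonneg (by omega)]
        push_cast
        ring
      rw [this]
      refine hcon.trans_le ?_
      exact_mod_cast Finset.card_le_card
        (Finset.inter_subset_inter_left (Finset.Ico_subset_Ico_left (by omega)))
    · by_contra hcon
      push Not at hcon
      refine hb (hF a (b + 1) (by omega) (by omega) ?_ (Finset.mem_Ico.2 ⟨by omega, by omega⟩))
      have : ((Finset.Ico a (b + 1)).card : ℝ) = b - a + 1 := by
        rw [Int.card_Ico, ← Int.cast_natCast, Int.toNat_of_nonneg (by omega)]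
        push_cast
        ring
      rw [this]
      refine hcon.trans_le ?_
      exact_mod_cast Finset.card_le_card
        (Finset.inter_subset_inter_left (Finset.Ico_subset_Ico_right (by omega)))
  rw [hcard]
  have : 1 ≤ (b - a : ℝ) / N := (one_le_div hN').2 hlen'
  have h3 : γ * (b - a + 1) ≤ (b - a) * (γ * (1 + 1 / N)) := by
    have : (b - a : ℝ) * (γ * (1 + 1 / N)) = γ * ((b - a) + (b - a) / N) := by ring
    rw [this]
    gcongr
  linarith

/-! ### Coordinate lines and directional halos -/

theorem update_mem_piFinset {n : ℕ} {I : Fin n → Finset ℤ} {x : Fin n → ℤ}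
    (hx : x ∈ Fintype.piFinset I) {k : Fin n} {t : ℤ} (ht : t ∈ I k) :
    Function.update x k t ∈ Fintype.piFinset I := by
  rw [Fintype.mem_piFinset] at hx ⊢
  intro j
  by_cases hj : j = k
  · subst hj; simpa using ht
  · simpa [hj] using hx j

/-- Summing the line sums in a fixed direction counts every point once per point of its line. -/
theorem sum_sum_update {n : ℕ} (I : Fin n → Finset ℤ) (k : Fin n) (φ : (Fin n → ℤ) → ℝ) :
    ∑ x ∈ Fintype.piFinset I, ∑ t ∈ I k, φ (Function.update x k t) =
      (I k).card * ∑ x ∈ Fintype.piFinset I, φ x := by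
  have h1 : ((I k).card : ℝ) * ∑ x ∈ Fintype.piFinset I, φ x =
      ∑ x ∈ Fintype.piFinset I, ∑ t ∈ I k, φ x := by
    simp [Finset.mul_sum]
  rw [h1, ← Finset.sum_product', ← Finset.sum_product']
  -- Exchanging t with the k-th coordinate of x is an involution.
  refine Finset.sum_nbij' (fun z => (Function.update z.1 k z.2, z.1 k))
    (fun z => (Function.update z.1 k z.2, z.1 k)) ?_ ?_ ?_ ?_ ?_
  · rintro ⟨x, t⟩ hz
    rw [Finset.mem_product] at hz ⊢
    exact ⟨update_mem_piFinset hz.1 hz.2, Fintype.mem_piFinset.1 hz.1 k⟩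
  · rintro ⟨x, t⟩ hz
    rw [Finset.mem_product] at hz ⊢
    exact ⟨update_mem_piFinset hz.1 hz.2, Fintype.mem_piFinset.1 hz.1 k⟩
  · rintro ⟨x, t⟩ -
    simp
  · rintro ⟨x, t⟩ -
    simp
  · rintro ⟨x, t⟩ -
    simp

/-- The integers `t` for which the `k`-th coordinate of `x` can be replaced by `t` to get a point
of `E`. -/
def line {n : ℕ} (E : Finset (Fin n → ℤ)) (k : Fin n) (x : Fin n → ℤ) : Finset ℤ :=
  (E.filter fun z => ∀ j, j ≠ k → z j = x j).image fun z => z k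

theorem mem_line {n : ℕ} {E : Finset (Fin n → ℤ)} {k : Fin n} {x : Fin n → ℤ} {t : ℤ} :
    t ∈ line E k x ↔ Function.update x k t ∈ E := by
  simp only [line, Finset.mem_image, Finset.mem_filter]
  constructor
  · rintro ⟨z, ⟨hz, hzx⟩, rfl⟩
    convert hz using 1
    ext j
    by_cases hj : j = k
    · subst hj; simp
    · simp [hj, hzx j hj]
  · intro h
    exact ⟨_, ⟨h, fun j hj => by simp [hj]⟩, by simp⟩

theorem line_update {n : ℕ} (E : Finset (Fin n → ℤ)) (k : Fin n) (x : Fin n → ℤ) (t : ℤ) :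
    line E k (Function.update x k t) = line E k x := by
  ext s
  simp [mem_line]

/-- The halo of `E` for the uncentred maximal function in the direction `k`. -/
def lineHalo {n : ℕ} (k : Fin n) (s : ℝ) (E : Finset (Fin n → ℤ)) : Set (Fin n → ℤ) :=
  {x | ∃ u v : ℤ, x k ∈ Finset.Ico u v ∧
    s * ((Finset.Ico u v).card : ℝ) < ((line E k x ∩ Finset.Ico u v).card : ℝ)}

theorem card_line_eq {n : ℕ} (E : Finset (Fin n → ℤ)) (k : Fin n) (x : Fin n → ℤ) :
    (line E k x).card = (E.filter fun z => ∀ j, j ≠ k → z j = x j).card := by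
  refine Finset.card_image_of_injOn fun z hz z' hz' h => ?_
  simp only [Finset.coe_filter, Set.mem_ofPred_eq] at hz hz'
  ext j
  by_cases hj : j = k
  · subst hj; exact h
  · rw [hz.2 j hj, hz'.2 j hj]

/-- The halo in direction k splits along the lines parallel to that direction, and on each line the
one-dimensional bound applies. Lines are indexed by their point with k-th coordinate 0. -/
theorem card_le_of_subset_lineHalo {n : ℕ} (k : Fin n) {s : ℝ} (hs : 0 < s) (hs1 : s ≤ 1)
    (E G : Finset (Fin n → ℤ)) (hG : ∀ x ∈ G, x ∈ lineHalo k s E) :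
    (G.card : ℝ) ≤ (2 / s - 1) * E.card := by
  classical
  set π : (Fin n → ℤ) → (Fin n → ℤ) := fun x => Function.update x k 0 with hπ
  set T := (G ∪ E).image π with hT
  have hfib : ∀ W : Finset (Fin n → ℤ), W ⊆ G ∪ E →
      W.card = ∑ y ∈ T, (line W k y).card := by
    intro W hW
    rw [Finset.card_eq_sum_card_fiberwise (f := π) (t := T)
      (fun x hx => Finset.mem_image_of_mem _ (hW hx))]
    refine Finset.sum_congr rfl fun y hy => ?_
    rw [card_line_eq]
    congr 1
    refine Finset.filter_congr fun z _ => ?_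
    obtain ⟨y', -, rfl⟩ := Finset.mem_image.1 hy
    simp only [hπ]
    constructor
    · intro h j hj
      have := congrFun h j
      simpa [hj] using this
    · intro h
      ext j
      by_cases hj : j = k
      · subst hj; simp
      · simpa [hj] using h j hj
  rw [hfib G Finset.subset_union_left, hfib E Finset.subset_union_right]
  push_cast
  rw [Finset.mul_sum]
  refine Finset.sum_le_sum fun y _ => card_le_of_dense_intervals hs hs1 _ _ fun t ht => ?_
  obtain ⟨u, v, h1, h2⟩ := hG _ (mem_line.1 ht)
  rw [line_update] at h2
  exact ⟨u, v, by simpa using h1, h2⟩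

/-- Weak type bounds are proved for finite subsets G of a halo; this turns them into finiteness of
the halo itself. -/
theorem finite_of_forall_finset_card_le {α : Type*} {S : Set α} {B : ℝ}
    (h : ∀ G : Finset α, (∀ x ∈ G, x ∈ S) → (G.card : ℝ) ≤ B) : S.Finite := by
  by_contra hS
  obtain ⟨G, hG, hc⟩ := Set.Infinite.exists_subset_card_eq hS (⌈B⌉₊ + 1)
  have h1 := h G fun x hx => hG hx
  rw [hc] at h1
  push_cast at h1
  linarith [Nat.le_ceil B]

theorem lineHalo_finite {n : ℕ} (k : Fin n) {s : ℝ} (hs : 0 < s) (hs1 : s ≤ 1)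
    (E : Finset (Fin n → ℤ)) : (lineHalo k s E).Finite :=
  finite_of_forall_finset_card_le (card_le_of_subset_lineHalo k hs hs1 E)

/-! ### Halos at levels close to 1 -/

/-- The lattice box `∏ [pᵢ, qᵢ)`. -/
noncomputable def box {n : ℕ} (p q : Fin n → ℤ) : Finset (Fin n → ℤ) :=
  Fintype.piFinset fun i => Finset.Ico (p i) (q i)

theorem mem_box {n : ℕ} {p q x : Fin n → ℤ} : x ∈ box p q ↔ ∀ i, p i ≤ x i ∧ x i < q i := by
  simp [box]

/-- The points that lie in a lattice box in which `E` has density more than `α`. -/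
def halo {n : ℕ} (α : ℝ) (E : Finset (Fin n → ℤ)) : Set (Fin n → ℤ) :=
  {m | ∃ p q : Fin n → ℤ, m ∈ box p q ∧ α * ((box p q).card : ℝ) < ((E ∩ box p q).card : ℝ)}

/-- If `E 0, E 1, …` are successive directional halos, in the directions `0, 1, …`, then a box
almost filled by `E 0` is contained in `E n`. -/
theorem box_subset_of_lineHalo_subset {n : ℕ} {η : ℝ} (hη : 0 < η)
    (E : ℕ → Finset (Fin n → ℤ))
    (hE : ∀ k : Fin n, ∀ x, x ∈ lineHalo k (1 - η) (E k) → x ∈ E (k + 1))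
    (p q : Fin n → ℤ) (hd : (1 - η ^ n) * ((box p q).card : ℝ) < ((E 0 ∩ box p q).card : ℝ)) :
    box p q ⊆ E n := by
  classical
  set R := box p q with hR
  -- Membership of y ∈ R in `Bad k` depends only on the coordinates from k on: the earlier ones may
  -- be changed within R to find a point outside `E k`.
  set Bad : ℕ → Finset (Fin n → ℤ) := fun k =>
    R.filter fun y => ∃ x ∈ R, (∀ i : Fin n, k ≤ i → x i = y i) ∧ x ∉ E k with hBad
  have step : ∀ k : Fin n, η * ((Bad (k + 1)).card : ℝ) ≤ (Bad k).card := by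
    intro k
    have hsum := sum_sum_update (fun i => Finset.Ico (p i) (q i)) k
      (fun x => if x ∈ Bad k then (1 : ℝ) else 0)
    change ∑ x ∈ R, _ = _ * ∑ x ∈ R, _ at hsum
    have hBR : ∀ k, Bad k ⊆ R := fun k => Finset.filter_subset _ _
    rw [Finset.sum_boole, Finset.filter_mem_eq_inter, Finset.inter_eq_right.2 (hBR _)] at hsum
    rcases R.eq_empty_or_nonempty with hRe | ⟨x₀, hx₀⟩
    · have : Bad (k + 1) = ∅ := Finset.subset_empty.1 (hRe ▸ hBR _)
      simp [this]
    have hL : 0 < ((Finset.Ico (p k) (q k)).card : ℝ) := by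
      have := mem_box.1 hx₀ k
      exact_mod_cast Finset.card_pos.2 ⟨x₀ k, Finset.mem_Ico.2 this⟩
    set L := ((Finset.Ico (p k) (q k)).card : ℝ) with hLdef
    have hle : ∑ y ∈ Bad (k + 1), η * L ≤
        ∑ x ∈ R, ∑ t ∈ Finset.Ico (p k) (q k),
          if Function.update x k t ∈ Bad k then (1 : ℝ) else 0 := by
      refine (Finset.sum_le_sum fun y hy => ?_).trans
        (Finset.sum_le_sum_of_subset_of_nonneg (hBR (k + 1)) fun x _ _ =>
          Finset.sum_nonneg fun t _ => by split_ifs <;> norm_num)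
      rw [Finset.sum_boole]
      obtain ⟨hyR, x, hxR, hxy, hxE⟩ := Finset.mem_filter.1 hy
      -- The witness x is outside `E (k + 1)`, so at least a proportion η of its k-line in R misses
      -- `E k`. Moving y to these positions lands in `Bad k`.
      have hnot : ¬ (1 - η) * L < ((line (E k) k x ∩ Finset.Ico (p k) (q k)).card : ℝ) :=
        fun h => hxE (hE k x ⟨p k, q k, Finset.mem_Ico.2 (mem_box.1 hxR k), h⟩)
      push Not at hnot
      have hsub : Finset.Ico (p k) (q k) \ line (E k) k x ⊆
          (Finset.Ico (p k) (q k)).filter fun t => Function.update y k t ∈ Bad k := by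
        intro t ht
        rw [Finset.mem_sdiff, mem_line] at ht
        refine Finset.mem_filter.2 ⟨ht.1, Finset.mem_filter.2 ⟨update_mem_piFinset hyR ht.1,
          Function.update x k t, update_mem_piFinset hxR ht.1, fun i hi => ?_, ht.2⟩⟩
        by_cases hik : i = k
        · subst hik; simp
        · have : (k : ℕ) + 1 ≤ i := by
            have : (i : ℕ) ≠ k := fun h => hik (Fin.ext h)
            omega
          simp [hik, hxy i this]
      have hc := Finset.card_le_card hsub
      have hsd := Finset.card_sdiff_add_card_inter (Finset.Ico (p k) (q k)) (line (E k) k x)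
      rw [Finset.inter_comm] at hsd
      have hsd' : ((Finset.Ico (p k) (q k) \ line (E k) k x).card : ℝ) +
          ((line (E k) k x ∩ Finset.Ico (p k) (q k)).card : ℝ) = L := by
        rw [hLdef]; exact_mod_cast hsd
      have hc' : ((Finset.Ico (p k) (q k) \ line (E k) k x).card : ℝ) ≤ _ := Nat.cast_le.2 hc
      linarith
    rw [hsum, Finset.sum_const, nsmul_eq_mul] at hle
    have : L * (η * (Bad (k + 1)).card) ≤ L * (Bad k).card := by linarith
    exact le_of_mul_le_mul_left this hL
  have hpow : ∀ k : ℕ, k ≤ n → η ^ k * ((Bad k).card : ℝ) ≤ (Bad 0).card := by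
    intro k
    induction k with
    | zero => intro _; simp
    | succ k ih =>
      intro hk
      have h1 := step ⟨k, hk⟩
      have h2 := ih (by omega)
      calc η ^ (k + 1) * ((Bad (k + 1)).card : ℝ) = η ^ k * (η * (Bad (k + 1)).card) := by ring
        _ ≤ η ^ k * (Bad k).card := by gcongr
        _ ≤ _ := h2
  have hBad0 : ((Bad 0).card : ℝ) < η ^ n * R.card := by
    have hsub : Bad 0 ⊆ R \ E 0 := by
      intro y hy
      obtain ⟨hyR, x, hxR, hxy, hxE⟩ := Finset.mem_filter.1 hy
      have : x = y := funext fun i => hxy i (Nat.zero_le _)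
      exact Finset.mem_sdiff.2 ⟨hyR, this ▸ hxE⟩
    have hc : ((Bad 0).card : ℝ) ≤ (R \ E 0).card := by exact_mod_cast Finset.card_le_card hsub
    have hsd := Finset.card_sdiff_add_card_inter R (E 0)
    rw [Finset.inter_comm] at hsd
    have hsd' : ((R \ E 0).card : ℝ) + ((E 0 ∩ R).card : ℝ) = R.card := by exact_mod_cast hsd
    linarith
  intro x hx
  by_contra hxE
  -- No coordinates are left to match, so a single missed point makes all of R bad, against `hpow`
  -- and `hBad0`.
  have hall : Bad n = R := by
    refine Finset.filter_true_of_mem fun y _ => ⟨x, hx, fun i hi => ?_, hxE⟩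
    exact absurd i.2 (by omega)
  have := hpow n le_rfl
  rw [hall] at this
  linarith

/-- Iterated directional halos `D k` of E at level 1 - η swallow every box of density above 1 - ηⁿ,
and each of the n steps multiplies the cardinality by at most 2/(1-η) - 1. -/
theorem card_le_of_subset_halo {n : ℕ} {η : ℝ} (hη : 0 < η) (hη1 : η < 1)
    (E G : Finset (Fin n → ℤ)) (hG : ∀ x ∈ G, x ∈ halo (1 - η ^ n) E) :
    (G.card : ℝ) ≤ (2 / (1 - η) - 1) ^ n * E.card := by
  classical
  have hs : 0 < 1 - η := by linarith
  have hs1 : 1 - η ≤ 1 := by linarith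
  have hC : 0 ≤ 2 / (1 - η) - 1 := by
    rw [sub_nonneg, one_le_div hs]; linarith
  let D : ℕ → Finset (Fin n → ℤ) := fun k => Nat.rec E
    (fun k A => if h : k < n then (lineHalo_finite ⟨k, h⟩ hs hs1 A).toFinset else A) k
  have hD : ∀ k : Fin n, D (k + 1) = (lineHalo_finite k hs hs1 (D k)).toFinset := by
    intro k
    change (if h : (k : ℕ) < n then (lineHalo_finite ⟨k, h⟩ hs hs1 (D k)).toFinset else D k) = _
    rw [dif_pos k.2]
  have hGD : G ⊆ D n := by
    intro x hx
    obtain ⟨p, q, hxb, hd⟩ := hG x hx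
    exact box_subset_of_lineHalo_subset hη D
      (fun k x hx => by rw [hD]; exact (Set.Finite.mem_toFinset _).2 hx) p q hd hxb
  have hcard : ∀ k : ℕ, k ≤ n → ((D k).card : ℝ) ≤ (2 / (1 - η) - 1) ^ k * E.card := by
    intro k
    induction k with
    | zero => intro _; simp [D]
    | succ k ih =>
      intro hk
      have h1 := card_le_of_subset_lineHalo ⟨k, hk⟩ hs hs1 (D k) (D (k + 1)) fun x hx => by
        rw [hD ⟨k, hk⟩] at hx
        exact (Set.Finite.mem_toFinset _).1 hx
      refine h1.trans ?_
      rw [pow_succ', mul_assoc]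
      gcongr
      exact ih (by omega)
  exact (Nat.cast_le.2 (Finset.card_le_card hGD)).trans (hcard n le_rfl)

theorem halo_mono {n : ℕ} {α β : ℝ} (h : α ≤ β) (E : Finset (Fin n → ℤ)) :
    halo β E ⊆ halo α E := by
  rintro m ⟨p, q, hm, hd⟩
  exact ⟨p, q, hm, lt_of_le_of_lt (by gcongr) hd⟩

theorem exists_one_sub_pow_eq {n : ℕ} (hn : n ≠ 0) {α : ℝ} (h0 : 0 < α) (h1 : α < 1) :
    ∃ η : ℝ, 0 < η ∧ η < 1 ∧ 1 - η ^ n = α := by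
  refine ⟨(1 - α) ^ ((n : ℝ)⁻¹), Real.rpow_pos_of_pos (by linarith) _, ?_, ?_⟩
  · exact Real.rpow_lt_one (by linarith) (by linarith) (by positivity)
  · rw [Real.rpow_inv_natCast_pow (by linarith) hn]
    ring

theorem halo_finite {n : ℕ} (hn : n ≠ 0) {α : ℝ} (h0 : 0 < α) (h1 : α < 1)
    (E : Finset (Fin n → ℤ)) : (halo α E).Finite := by
  obtain ⟨η, h, h', rfl⟩ := exists_one_sub_pow_eq hn h0 h1
  exact finite_of_forall_finset_card_le (card_le_of_subset_halo h h' E)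

/-! ### Efron–Stein and gains along lines -/

/-- The counting form of the Efron–Stein inequality for an indicator function on a product. -/
theorem card_mul_card_sdiff_le {n : ℕ} (I : Fin n → Finset ℤ) (E : Finset (Fin n → ℤ))
    (hE : E ⊆ Fintype.piFinset I) :
    E.card * (Fintype.piFinset I \ E).card ≤ ∑ k : Fin n,
      ((E ×ˢ Fintype.piFinset I).filter fun z => Function.update z.1 k (z.2 k) ∉ E).card := by
  classical
  set R := Fintype.piFinset I with hR
  -- `mix k x y` takes its first k coordinates from y and the rest from x. This path from x ∈ E to y
  -- ∉ E must leave E at some step k.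
  let mix : ℕ → (Fin n → ℤ) → (Fin n → ℤ) → (Fin n → ℤ) :=
    fun k x y i => if (i : ℕ) < k then y i else x i
  have hmix : ∀ k x y, x ∈ R → y ∈ R → mix k x y ∈ R := by
    intro k x y hx hy
    rw [hR, Fintype.mem_piFinset] at *
    intro i
    simp only [mix]
    split_ifs
    exacts [hy i, hx i]
  have hmixmix : ∀ k x y, mix k (mix k x y) (mix k y x) = x := by
    intro k x y
    ext i
    simp only [mix]
    split_ifs <;> rfl
  have hsucc : ∀ (k : Fin n) x y,
      Function.update (mix k x y) k (mix k y x k) = mix (k + 1) x y := by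
    intro k x y
    ext i
    by_cases hik : i = k
    · subst hik; simp [mix]
    · have : (i : ℕ) ≠ k := fun h => hik (Fin.ext h)
      have h2 : ((i : ℕ) < k + 1) ↔ (i : ℕ) < k := by omega
      simp [mix, hik, h2]
  let T : Fin n → Finset ((Fin n → ℤ) × (Fin n → ℤ)) := fun k =>
    (R ×ˢ R).filter fun z => mix k z.1 z.2 ∈ E ∧ mix (k + 1) z.1 z.2 ∉ E
  have hcover : E ×ˢ (R \ E) ⊆ Finset.univ.biUnion T := by
    rintro ⟨x, y⟩ hz
    rw [Finset.mem_product, Finset.mem_sdiff] at hz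
    by_contra hcon
    have hxR : x ∈ R := hE hz.1
    have hall : ∀ k : ℕ, k ≤ n → mix k x y ∈ E := by
      intro k
      induction k with
      | zero => intro _; simpa [mix] using hz.1
      | succ k ih =>
        intro hk
        by_contra hk'
        exact hcon (Finset.mem_biUnion.2 ⟨⟨k, hk⟩, Finset.mem_univ _, Finset.mem_filter.2
          ⟨Finset.mem_product.2 ⟨hxR, hz.2.1⟩, ih (by omega), hk'⟩⟩)
    have := hall n le_rfl
    simp only [mix, Fin.is_lt, if_true] at this
    exact hz.2.2 this
  rw [← Finset.card_product]
  refine (Finset.card_le_card hcover).trans (Finset.card_biUnion_le.trans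
    (Finset.sum_le_sum fun k _ => ?_))
  -- Swapping the first k coordinates of x and y is an involution of R × R; it turns an exit at step
  -- k into the replacement of one coordinate of a point of E.
  refine Finset.card_le_card_of_injOn (fun z => (mix k z.1 z.2, mix k z.2 z.1)) ?_ ?_
  · rintro ⟨x, y⟩ hz
    obtain ⟨hz1, hz2, hz3⟩ := Finset.mem_filter.1 hz
    rw [Finset.mem_product] at hz1
    refine Finset.mem_filter.2 ⟨Finset.mem_product.2 ⟨hz2, hmix k _ _ hz1.2 hz1.1⟩, ?_⟩
    simp only
    rwa [hsucc]
  · rintro ⟨x, y⟩ - ⟨x', y'⟩ - h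
    simp only [Prod.mk.injEq] at h
    have h1 : x = x' := by
      rw [← hmixmix k x y, h.1, h.2, hmixmix]
    have h2 : y = y' := by
      rw [← hmixmix k y x, h.1, h.2, hmixmix]
    rw [h1, h2]

/-- If `F` is larger than `E` on each line of a box, with gain proportional to the variance of `E`
on that line, then `F` is larger than `E` with gain proportional to the variance of `E`. -/
theorem card_gain_of_line_gain {n : ℕ} {κ : ℝ} (hκ : 0 ≤ κ) (I : Fin n → Finset ℤ)
    (E F : Finset (Fin n → ℤ)) (hE : E ⊆ Fintype.piFinset I) (hF : F ⊆ Fintype.piFinset I)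
    (h : ∀ k : Fin n, ∀ x ∈ Fintype.piFinset I,
      κ * (((I k ∩ line E k x).card : ℝ) * ((I k).card - (I k ∩ line E k x).card)) ≤
        ((I k ∩ line F k x).card - (I k ∩ line E k x).card) * (I k).card) :
    κ * ((E.card : ℝ) * ((Fintype.piFinset I).card - E.card)) ≤
      n * ((Fintype.piFinset I).card * ((F.card : ℝ) - E.card)) := by
  classical
  set R := Fintype.piFinset I with hR
  rcases R.eq_empty_or_nonempty with hRe | ⟨x₀, hx₀⟩
  · have h1 : E = ∅ := Finset.subset_empty.1 (hRe ▸ hE)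
    have h2 : F = ∅ := Finset.subset_empty.1 (hRe ▸ hF)
    simp [h1, h2]
  have hLpos : ∀ k, 0 < ((I k).card : ℝ) := fun k => by
    exact_mod_cast Finset.card_pos.2 ⟨x₀ k, Fintype.mem_piFinset.1 hx₀ k⟩
  have hlinecard : ∀ (W : Finset (Fin n → ℤ)) k x, ((I k ∩ line W k x).card : ℝ) =
      ∑ t ∈ I k, if Function.update x k t ∈ W then (1 : ℝ) else 0 := by
    intro W k x
    rw [Finset.sum_boole]
    congr 2
    ext t
    simp [mem_line]
  have hline : ∀ (W : Finset (Fin n → ℤ)) k, W ⊆ R →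
      ∑ x ∈ R, ((I k ∩ line W k x).card : ℝ) = (I k).card * W.card := by
    intro W k hW
    simp only [hlinecard]
    rw [sum_sum_update I k (fun x => if x ∈ W then (1 : ℝ) else 0), Finset.sum_boole,
      Finset.filter_mem_eq_inter, Finset.inter_eq_right.2 hW]
  -- Summed over z ∈ E, the number of points missing from the k-line through z gives, up to factors,
  -- both the total line variance (`hvar`) and the Efron–Stein term (`hP`).
  set d : Fin n → (Fin n → ℤ) → ℝ := fun k z => (I k).card - (I k ∩ line E k z).card with hd
  have hvar : ∀ k, ∑ x ∈ R, ((I k ∩ line E k x).card : ℝ) *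
      ((I k).card - (I k ∩ line E k x).card) = (I k).card * ∑ z ∈ E, d k z := by
    intro k
    have h1 := sum_sum_update I k (fun x => if x ∈ E then d k x else 0)
    rw [Finset.sum_ite_mem, Finset.inter_eq_right.2 hE] at h1
    rw [← h1]
    refine Finset.sum_congr rfl fun x _ => ?_
    rw [hlinecard, Finset.sum_mul]
    refine Finset.sum_congr rfl fun t _ => ?_
    rw [← hlinecard]
    simp only [hd, line_update]
    split_ifs <;> simp
  have hgain : ∀ k, κ * ∑ z ∈ E, d k z ≤ (I k).card * ((F.card : ℝ) - E.card) := by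
    intro k
    have h1 := Finset.sum_le_sum (h k)
    rw [← Finset.mul_sum, hvar, ← Finset.sum_mul, Finset.sum_sub_distrib (s := R), hline F k hF,
      hline E k hE] at h1
    refine le_of_mul_le_mul_left ?_ (hLpos k)
    linarith
  have hP : ∀ k, ((I k).card : ℝ) *
      ((E ×ˢ R).filter fun z => Function.update z.1 k (z.2 k) ∉ E).card =
        R.card * ∑ z ∈ E, d k z := by
    intro k
    rw [Finset.card_filter, Finset.sum_product]
    push_cast
    rw [Finset.mul_sum, Finset.mul_sum]
    refine Finset.sum_congr rfl fun z _ => ?_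
    have h1 := sum_sum_update I k
      (fun w => if Function.update z k (w k) ∉ E then (1 : ℝ) else 0)
    rw [← h1]
    simp only [Function.update_self]
    rw [Finset.sum_const, nsmul_eq_mul]
    congr 1
    simp only [hd]
    rw [hlinecard, eq_sub_iff_add_eq, ← Finset.sum_add_distrib]
    rw [Finset.card_eq_sum_ones]
    push_cast
    refine Finset.sum_congr rfl fun t _ => ?_
    split_ifs <;> simp_all
  have hES : (E.card : ℝ) * (R.card - E.card) ≤ ∑ k : Fin n,
      (((E ×ˢ R).filter fun z => Function.update z.1 k (z.2 k) ∉ E).card : ℝ) := by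
    have h1 := card_mul_card_sdiff_le I E hE
    have h2 : ((R \ E).card : ℝ) = R.card - E.card := by
      rw [Finset.card_sdiff_of_subset hE, Nat.cast_sub (Finset.card_le_card hE)]
    rw [← h2]
    exact_mod_cast h1
  calc κ * ((E.card : ℝ) * (R.card - E.card))
      ≤ κ * ∑ k : Fin n,
        (((E ×ˢ R).filter fun z => Function.update z.1 k (z.2 k) ∉ E).card : ℝ) := by gcongr
    _ = ∑ k : Fin n, κ *
        (((E ×ˢ R).filter fun z => Function.update z.1 k (z.2 k) ∉ E).card : ℝ) :=
        Finset.mul_sum _ _ _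
    _ ≤ ∑ _k : Fin n, (R.card : ℝ) * ((F.card : ℝ) - E.card) := by
        refine Finset.sum_le_sum fun k _ => le_of_mul_le_mul_left ?_ (hLpos k)
        have h1 := mul_le_mul_of_nonneg_left (hgain k) (Nat.cast_nonneg (α := ℝ) R.card)
        have h2 := hP k
        rw [mul_left_comm, h2]
        linarith
    _ = _ := by simp

/-! ### Dilations and halos of halos -/

/-- The dilation of `E` by the factor `N`: every point is replaced by a cube of side `N`. -/
noncomputable def dilate {n : ℕ} (N : ℕ) (E : Finset (Fin n → ℤ)) : Finset (Fin n → ℤ) :=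
  E.biUnion fun e => box (fun i => N * e i) (fun i => N * e i + N)

theorem mem_dilate {n N : ℕ} (hN : 0 < N) {E : Finset (Fin n → ℤ)} {x : Fin n → ℤ} :
    x ∈ dilate N E ↔ (fun i => x i / (N : ℤ)) ∈ E := by
  have hNz : (0 : ℤ) < N := by exact_mod_cast hN
  simp only [dilate, Finset.mem_biUnion, mem_box]
  constructor
  · rintro ⟨e, he, hx⟩
    convert he using 1
    ext i
    apply le_antisymm
    · exact Int.lt_add_one_iff.1 (Int.ediv_lt_of_lt_mul hNz (by linarith [(hx i).2]))
    · exact (Int.le_ediv_iff_mul_le hNz).2 (by linarith [(hx i).1])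
  · intro h
    refine ⟨_, h, fun i => ?_⟩
    have h1 := Int.ediv_mul_le (x i) hNz.ne'
    have h2 := Int.lt_ediv_add_one_mul_self (x i) hNz
    constructor <;> linarith

theorem card_dilate {n N : ℕ} (hN : 0 < N) (E : Finset (Fin n → ℤ)) :
    (dilate N E).card = N ^ n * E.card := by
  rw [dilate, Finset.card_biUnion]
  · simp [box, Fintype.card_piFinset, mul_comm]
  · intro e he e' he' hne
    rw [Function.onFun, Finset.disjoint_left]
    intro x hx hx'
    apply hne
    have h1 := (mem_dilate hN (E := {e})).1 (by simpa [dilate] using hx)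
    have h2 := (mem_dilate hN (E := {e'})).1 (by simpa [dilate] using hx')
    rw [Finset.mem_singleton] at h1 h2
    rw [← h1, ← h2]

theorem dilate_box {n N : ℕ} (hN : 0 < N) (p q : Fin n → ℤ) :
    dilate N (box p q) = box (fun i => N * p i) (fun i => N * q i) := by
  have hNz : (0 : ℤ) < N := by exact_mod_cast hN
  ext x
  rw [mem_dilate hN, mem_box, mem_box]
  refine forall_congr' fun i => ?_
  rw [Int.le_ediv_iff_mul_le hNz, Int.ediv_lt_iff_lt_mul hNz, mul_comm (p i), mul_comm (q i)]

theorem dilate_inter {n N : ℕ} (hN : 0 < N) (E F : Finset (Fin n → ℤ)) :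
    dilate N (E ∩ F) = dilate N E ∩ dilate N F := by
  ext x
  simp [mem_dilate hN]

theorem subset_halo {n : ℕ} {γ : ℝ} (hγ : γ < 1) (E : Finset (Fin n → ℤ)) {x : Fin n → ℤ}
    (hx : x ∈ E) : x ∈ halo γ E := by
  have hxb : x ∈ box x (fun i => x i + 1) := mem_box.2 fun i => ⟨le_rfl, by omega⟩
  refine ⟨x, fun i => x i + 1, hxb, ?_⟩
  have h1 : (box x fun i => x i + 1).card = 1 := by simp [box, Fintype.card_piFinset]
  have h2 : 1 ≤ (E ∩ box x fun i => x i + 1).card :=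
    Finset.card_pos.2 ⟨x, Finset.mem_inter.2 ⟨hx, hxb⟩⟩
  have h2' : (1 : ℝ) ≤ (E ∩ box x fun i => x i + 1).card := by exact_mod_cast h2
  rw [h1]
  push_cast
  linarith

theorem card_box_update {n : ℕ} (x : Fin n → ℤ) (k : Fin n) (u v : ℤ) :
    (box (Function.update x k u) (Function.update (fun i => x i + 1) k v)).card =
      (Finset.Ico u v).card := by
  rw [box, Fintype.card_piFinset, Finset.prod_eq_single k]
  · simp
  · intro i _ hi
    simp [hi]
  · simp

/-- An interval on a line is a box of width 1 in the other directions, so the halo contains the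
directional halos. -/
theorem update_mem_halo {n : ℕ} {γ : ℝ} {E : Finset (Fin n → ℤ)} {x : Fin n → ℤ} {k : Fin n}
    {u v t : ℤ} (ht : t ∈ Finset.Ico u v)
    (h : γ * ((Finset.Ico u v).card : ℝ) < ((line E k x ∩ Finset.Ico u v).card : ℝ)) :
    Function.update x k t ∈ halo γ E := by
  have hmem : ∀ t ∈ Finset.Ico u v, Function.update x k t ∈
      box (Function.update x k u) (Function.update (fun i => x i + 1) k v) := by
    intro t ht
    rw [mem_box]
    intro i
    by_cases hi : i = k
    · subst hi; simpa using ht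
    · simp [hi]
  refine ⟨_, _, hmem t ht, ?_⟩
  rw [card_box_update]
  refine h.trans_le ?_
  have : (line E k x ∩ Finset.Ico u v).card ≤ _ :=
    Finset.card_le_card_of_injOn (t := E ∩ box (Function.update x k u)
      (Function.update (fun i => x i + 1) k v)) (fun t => Function.update x k t)
      (fun t ht => by
        have ht := Finset.mem_inter.1 ht
        exact Finset.mem_inter.2 ⟨mem_line.1 ht.1, hmem t ht.2⟩)
      (fun t _ t' _ htt => Function.update_injective x k htt)
  exact_mod_cast this

/-- After a dilation, a halo is contained in a halo, at a higher level, of a halo at a level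
close to `1`. -/
theorem dilate_subset_halo_halo {n N : ℕ} {α β ε : ℝ} (hN : 0 < N) (hα : 0 < α)
    (hαβ : α < β) (hβ : β < 1) (hε : 0 < ε) (hε1 : ε < 1)
    (hεN : (1 - ε) * (1 + 1 / N) ≤ 1 - ε / 2)
    (hgap : 2 * n * (β - α) ≤ ε * (α * (1 - β)))
    (E F H : Finset (Fin n → ℤ)) (hF : ∀ x, x ∈ F ↔ x ∈ halo (1 - ε) (dilate N E))
    (hH : ∀ x ∈ H, x ∈ halo α E) :
    ∀ x ∈ dilate N H, x ∈ halo β F := by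
  intro m hm
  obtain ⟨p, q, hmR, hd⟩ := hH _ ((mem_dilate hN).1 hm)
  have hNr : (0 : ℝ) < N := by exact_mod_cast hN
  set E' := dilate N E with hE'
  set I : Fin n → Finset ℤ := fun i => Finset.Ico (N * p i) (N * q i) with hI
  set R := Fintype.piFinset I with hR
  have hRd : R = dilate N (box p q) := by rw [dilate_box hN]; rfl
  have hmR' : m ∈ R := by rw [hRd]; exact (mem_dilate hN).2 hmR
  have hd' : α * (R.card : ℝ) < ((E' ∩ R).card : ℝ) := by
    rw [hRd, hE', ← dilate_inter hN, card_dilate hN, card_dilate hN]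
    push_cast
    rw [mul_left_comm]
    exact mul_lt_mul_of_pos_left hd (by positivity)
  have hEF : E' ⊆ F := fun x hx => (hF x).2 (subset_halo (by linarith) _ hx)
  have hEFc : ((E' ∩ R).card : ℝ) ≤ (F ∩ R).card := by
    exact_mod_cast Finset.card_le_card (Finset.inter_subset_inter_right hEF)
  refine ⟨fun i => N * p i, fun i => N * q i, hmR', ?_⟩
  change β * (R.card : ℝ) < ((F ∩ R).card : ℝ)
  rcases lt_or_ge (β * (R.card : ℝ)) ((E' ∩ R).card : ℝ) with hθ | hθ
  -- If the density already exceeds β there is nothing to gain. Otherwise it lies in (α, β], which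
  -- bounds the variance below by α(1-β)r², with r the size of R.
  · exact hθ.trans_le hEFc
  have hRpos : (0 : ℝ) < R.card := by exact_mod_cast Finset.card_pos.2 ⟨m, hmR'⟩
  have hgain := card_gain_of_line_gain (κ := ε / 2) (by linarith) I (E' ∩ R) (F ∩ R)
    Finset.inter_subset_right Finset.inter_subset_right ?_
  · change ε / 2 * ((E' ∩ R).card * ((R.card : ℝ) - (E' ∩ R).card)) ≤
      n * (R.card * (((F ∩ R).card : ℝ) - (E' ∩ R).card)) at hgain
    set r := (R.card : ℝ)
    set e := ((E' ∩ R).card : ℝ)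
    set f := ((F ∩ R).card : ℝ)
    have h1 : (α * r) * ((1 - β) * r) ≤ e * (r - e) := by
      apply mul_le_mul hd'.le (by linarith) (by nlinarith) (Nat.cast_nonneg _)
    have h2 : n * (β - α) * r * r ≤ n * (r * (f - e)) := by
      nlinarith [mul_le_mul_of_nonneg_right hgap (mul_nonneg hRpos.le hRpos.le)]
    by_contra hcon
    push Not at hcon
    have hlt : f - e < (β - α) * r := by linarith
    rcases Nat.eq_zero_or_pos n with hn | hn
    · subst hn
      simp only [CharP.cast_eq_zero, mul_zero, zero_mul] at hgain hgap
      nlinarith [mul_pos (mul_pos hα hRpos) (mul_pos (sub_pos.2 hβ) hRpos)]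
    · have hn' : (0 : ℝ) < n := by exact_mod_cast hn
      nlinarith [mul_pos (mul_pos hn' hRpos) (sub_pos.2 hlt)]
  intro k x hx
  have hline : ∀ W : Finset (Fin n → ℤ), I k ∩ line (W ∩ R) k x = I k ∩ line W k x := by
    intro W
    ext t
    simp only [Finset.mem_inter, mem_line]
    exact ⟨fun h => ⟨h.1, h.2.1⟩, fun h => ⟨h.1, h.2, update_mem_piFinset hx h.1⟩⟩
  rw [hline, hline]
  have hsub : I k ∩ line E' k x ⊆ I k ∩ line F k x := by
    refine Finset.inter_subset_inter_left fun t ht => ?_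
    exact mem_line.2 (hEF (mem_line.1 ht))
  have hNz : (0 : ℤ) < N := by exact_mod_cast hN
  have hmain := eq_or_card_le_of_blocks (γ := 1 - ε) (by linarith) hN
    (p := N * p k) (q := N * q k) (S := I k ∩ line E' k x) (F := I k ∩ line F k x)
    Finset.inter_subset_left hsub ?_ ?_
  · have hef : ((I k ∩ line E' k x).card : ℝ) ≤ (I k ∩ line F k x).card := by
      exact_mod_cast Finset.card_le_card hsub
    have hfL : ((I k ∩ line F k x).card : ℝ) ≤ (I k).card := by
      exact_mod_cast Finset.card_le_card Finset.inter_subset_left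
    have he0 : (0 : ℝ) ≤ (I k ∩ line E' k x).card := Nat.cast_nonneg _
    -- Either F fills the line, or it exceeds E' there by at least ε/2 times E'; both give the gain
    -- with κ = ε/2.
    rcases hmain with h | h
    · rw [h]
      change _ ≤ (((I k).card : ℝ) - _) * _
      have : ε / 2 * ((I k ∩ line E' k x).card : ℝ) ≤ (I k).card := by nlinarith
      nlinarith [mul_le_mul_of_nonneg_right this (sub_nonneg.2 (hef.trans hfL))]
    · have h2 : ((I k ∩ line E' k x).card : ℝ) ≤ (1 - ε / 2) * (I k ∩ line F k x).card :=
        h.trans (by gcongr)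
      have h3 : ε / 2 * ((I k ∩ line E' k x).card : ℝ) ≤
          (I k ∩ line F k x).card - (I k ∩ line E' k x).card := by nlinarith
      calc _ = (ε / 2 * ((I k ∩ line E' k x).card : ℝ)) *
            ((I k).card - (I k ∩ line E' k x).card) := by ring
        _ ≤ ((I k ∩ line F k x).card - (I k ∩ line E' k x).card) *
            ((I k).card - (I k ∩ line E' k x).card) :=
            mul_le_mul_of_nonneg_right h3 (by linarith)
        _ ≤ _ := mul_le_mul_of_nonneg_left (by linarith) (by linarith)
  · intro t ht t' htt
    rw [Finset.mem_inter, mem_line, hE', mem_dilate hN] at ht ⊢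
    constructor
    · have := Finset.mem_Ico.1 ht.1
      rw [hI, Finset.mem_Ico]
      have h1 : p k ≤ t / N := (Int.le_ediv_iff_mul_le hNz).2 (by linarith)
      have h2 : t / N < q k := (Int.ediv_lt_iff_lt_mul hNz).2 (by linarith)
      rw [← htt] at h1 h2
      constructor
      · linarith [(Int.le_ediv_iff_mul_le hNz).1 h1]
      · linarith [(Int.ediv_lt_iff_lt_mul hNz).1 h2]
    · convert ht.2 using 2 with i
      by_cases hi : i = k
      · subst hi; simp [htt]
      · simp [hi]
  · intro u v hu hv hdens t ht
    have ht' := Finset.mem_Ico.1 ht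
    refine Finset.mem_inter.2 ⟨Finset.mem_Ico.2 ⟨by omega, by omega⟩, mem_line.2 ((hF _).2 ?_)⟩
    refine update_mem_halo ht (hdens.trans_le ?_)
    exact_mod_cast Finset.card_le_card
      (Finset.inter_subset_inter_right Finset.inter_subset_right)

/-! ### From real rectangles to lattice boxes -/

theorem latticePoints_pi_Ioo {n : ℕ} (a b : Fin n → ℝ) :
    latticePoints (Set.univ.pi fun i => Set.Ioo (a i) (b i)) =
      ↑(box (fun i => ⌊a i⌋ + 1) (fun i => ⌈b i⌉)) := by
  ext j
  simp only [latticePoints, Set.mem_ofPred_eq, Set.mem_univ_pi, Set.mem_Ioo, Finset.mem_coe,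
    mem_box, Int.add_one_le_iff, Int.floor_lt, Int.lt_ceil]

theorem average_indicator_eq {n : ℕ} (E : Finset (Fin n → ℤ)) (m : Fin n → ℤ)
    {L : Set (Fin n → ℤ)} {p q : Fin n → ℤ} (hL : L = ↑(box p q)) (h0 : (box p q).Nonempty) :
    (∑' j : L, ENNReal.ofReal |(E : Set (Fin n → ℤ)).indicator (fun _ => (1 : ℝ)) (m + j)|) /
        (L.encard : ℝ≥0∞) =
      ENNReal.ofReal (((E ∩ box (m + p) (m + q)).card : ℝ) / (box (m + p) (m + q)).card) := by
  classical
  subst hL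
  have hcard : (box (m + p) (m + q)).card = (box p q).card := by
    simp [box, Fintype.card_piFinset]
  have hpos : (0 : ℝ) < (box p q).card := by exact_mod_cast Finset.card_pos.2 h0
  have hsum : (∑' j : ↥(box p q : Set (Fin n → ℤ)),
      ENNReal.ofReal |(E : Set (Fin n → ℤ)).indicator (fun _ => (1 : ℝ)) (m + j)|) =
        ((E ∩ box (m + p) (m + q)).card : ℝ≥0∞) := by
    have h1 := Finset.tsum_subtype (box p q) fun j =>
      ENNReal.ofReal |(E : Set (Fin n → ℤ)).indicator (fun _ => (1 : ℝ)) (m + j)|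
    refine h1.trans ?_
    have h2 : ∀ j, ENNReal.ofReal |(E : Set (Fin n → ℤ)).indicator (fun _ => (1 : ℝ)) (m + j)| =
        if m + j ∈ E then 1 else 0 := by
      intro j
      by_cases hj : m + j ∈ E <;> simp [hj]
    simp only [h2]
    rw [Finset.sum_boole]
    congr 1
    refine Finset.card_nbij' (fun j => m + j) (fun x => x - m) ?_ ?_ ?_ ?_
    · intro j hj
      obtain ⟨h1, h2⟩ := Finset.mem_filter.1 hj
      rw [mem_box] at h1
      refine Finset.mem_inter.2 ⟨h2, mem_box.2 fun i => ?_⟩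
      simpa using h1 i
    · intro x hx
      obtain ⟨h1, h2⟩ := Finset.mem_inter.1 hx
      rw [mem_box] at h2
      refine Finset.mem_filter.2 ⟨mem_box.2 fun i => ?_, by simpa using h1⟩
      have := h2 i
      simp only [Pi.add_apply, Pi.sub_apply] at this ⊢
      omega
    · intro j _; simp
    · intro j _; simp
  rw [hsum, hcard, ENNReal.ofReal_div_of_pos hpos, ENNReal.ofReal_natCast,
    ENNReal.ofReal_natCast, Set.encard_coe_eq_coe_finsetCard]
  simp

/-- A supremum exceeds α exactly when some average does, and translation by m turns the averages
into densities of E in lattice boxes containing m. -/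
theorem discreteHalo_eq {n : ℕ} {α : ℝ} (hα : 0 ≤ α) (E : Finset (Fin n → ℤ)) :
    discreteHalo α (E : Set (Fin n → ℤ)) = halo α E := by
  ext m
  simp only [discreteHalo, discreteStrongMaximal, Set.mem_ofPred_eq, lt_iSup_iff]
  have hbox : ∀ p q : Fin n → ℤ, (box p q).Nonempty →
      (ENNReal.ofReal α < ENNReal.ofReal
        (((E ∩ box p q).card : ℝ) / (box p q).card) ↔
        α * ((box p q).card : ℝ) < ((E ∩ box p q).card : ℝ)) := by
    intro p q hne
    have hpos : (0 : ℝ) < (box p q).card := by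
      exact_mod_cast Finset.card_pos.2 hne
    rw [ENNReal.ofReal_lt_ofReal_iff_of_nonneg hα, lt_div_iff₀ hpos]
  constructor
  · rintro ⟨R, ⟨a, b, rfl⟩, h0, h⟩
    have h0' : (0 : Fin n → ℤ) ∈ box (fun i => ⌊a i⌋ + 1) (fun i => ⌈b i⌉) := by
      rw [← Finset.mem_coe, ← latticePoints_pi_Ioo]
      simpa [latticePoints] using h0
    have hm : m ∈ box (m + fun i => ⌊a i⌋ + 1) (m + fun i => ⌈b i⌉) := by
      rw [mem_box] at h0' ⊢
      intro i
      have := h0' i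
      simp only [Pi.zero_apply, Pi.add_apply] at this ⊢
      omega
    rw [average_indicator_eq E m (latticePoints_pi_Ioo a b) ⟨0, h0'⟩, hbox _ _ ⟨m, hm⟩] at h
    exact ⟨_, _, hm, h⟩
  · rintro ⟨p, q, hm, h⟩
    have hmb := mem_box.1 hm
    -- The rectangle is open, so its left end is put one unit below the first lattice point wanted.
    have hL : latticePoints (Set.univ.pi fun i =>
        Set.Ioo (((p i - m i - 1 : ℤ) : ℝ)) ((q i - m i : ℤ) : ℝ)) = ↑(box (p - m) (q - m)) := by
      rw [latticePoints_pi_Ioo]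
      congr 2
      · ext i; simp only [Int.floor_intCast, Pi.sub_apply]; ring
      · ext i; simp only [Int.ceil_intCast, Pi.sub_apply]
    have h0' : (0 : Fin n → ℤ) ∈ box (p - m) (q - m) := by
      rw [mem_box]
      intro i
      have := hmb i
      simp only [Pi.zero_apply, Pi.sub_apply]
      omega
    refine ⟨_, ⟨fun i => ((p i - m i - 1 : ℤ) : ℝ), fun i => ((q i - m i : ℤ) : ℝ), rfl⟩, ?_, ?_⟩
    · rw [← Finset.mem_coe, ← hL] at h0'
      simpa [latticePoints] using h0'
    · rw [average_indicator_eq E m hL ⟨0, h0'⟩, add_sub_cancel, add_sub_cancel, hbox _ _ ⟨m, hm⟩]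
      exact h

/-! ### Tauberian constants and the Hölder estimate -/

/-- `C` bounds the ratio of the size of the halo of level `α` to the size of the set. -/
def HaloBound (n : ℕ) (α C : ℝ) : Prop :=
  ∀ E G : Finset (Fin n → ℤ), (∀ x ∈ G, x ∈ halo α E) → (G.card : ℝ) ≤ C * E.card

theorem HaloBound.discreteTauberian_le {n : ℕ} {α C : ℝ} (hα : 0 ≤ α) (h : HaloBound n α C) :
    discreteTauberian n α ≤ ENNReal.ofReal C := by
  refine iSup_le fun E => iSup_le fun hne => iSup_le fun hfin => ?_
  lift E to Finset (Fin n → ℤ) using hfin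
  rw [discreteHalo_eq hα]
  have hpos : (0 : ℝ) < E.card := by
    exact_mod_cast Finset.card_pos.2 (Finset.coe_nonempty.1 hne)
  have hH : (halo α E).Finite := finite_of_forall_finset_card_le (h E)
  have hcard := h E hH.toFinset fun x hx => hH.mem_toFinset.1 hx
  rw [← div_le_iff₀ hpos] at hcard
  have := ENNReal.ofReal_le_ofReal hcard
  rw [ENNReal.ofReal_div_of_pos hpos, ENNReal.ofReal_natCast, ENNReal.ofReal_natCast] at this
  rw [hH.encard_eq_coe_toFinset_card, Set.encard_coe_eq_coe_finsetCard]
  simpa using this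

/-- Once finite, the Tauberian constant is itself an admissible bound. Finiteness matters because
`toReal` sends ⊤ to 0. -/
theorem haloBound_toReal_discreteTauberian {n : ℕ} {α : ℝ} (hα : 0 < α)
    (h : discreteTauberian n α < ⊤) : HaloBound n α (discreteTauberian n α).toReal := by
  intro E G hG
  rcases E.eq_empty_or_nonempty with rfl | hne
  · have : G = ∅ := by
      refine Finset.eq_empty_of_forall_notMem fun x hx => ?_
      obtain ⟨p, q, -, hd⟩ := hG x hx
      simp only [Finset.empty_inter, Finset.card_empty, Nat.cast_zero] at hd
      exact absurd hd (not_lt.2 (by positivity))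
    simp [this]
  have hpos : (0 : ℝ) < E.card := by exact_mod_cast Finset.card_pos.2 hne
  rw [← div_le_iff₀ hpos, ← ENNReal.ofReal_le_iff_le_toReal h.ne,
    ENNReal.ofReal_div_of_pos hpos, ENNReal.ofReal_natCast, ENNReal.ofReal_natCast]
  have h1 : ((discreteHalo α (E : Set (Fin n → ℤ))).encard : ℝ≥0∞) /
      ((E : Set (Fin n → ℤ)).encard : ℝ≥0∞) ≤ discreteTauberian n α := by
    unfold discreteTauberian
    refine le_iSup_of_le (E : Set (Fin n → ℤ)) ?_
    refine le_iSup_of_le (Finset.coe_nonempty.2 hne) ?_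
    exact le_iSup_of_le E.finite_toSet le_rfl
  refine le_trans ?_ h1
  rw [discreteHalo_eq hα.le, Set.encard_coe_eq_coe_finsetCard]
  have h2 : ((G : Set (Fin n → ℤ)).encard : ℝ≥0∞) ≤ (halo α E).encard :=
    ENat.toENNReal_le.2 (Set.encard_le_encard fun x hx => hG x hx)
  rw [Set.encard_coe_eq_coe_finsetCard, ENat.toENNReal_coe] at h2
  rw [ENat.toENNReal_coe]
  exact ENNReal.div_le_div_right h2 _

theorem haloBound_one_sub_pow {n : ℕ} {η : ℝ} (hη : 0 < η) (hη1 : η < 1) :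
    HaloBound n (1 - η ^ n) ((2 / (1 - η) - 1) ^ n) :=
  card_le_of_subset_halo hη hη1

theorem discreteTauberian_lt_top {n : ℕ} (hn : n ≠ 0) {α : ℝ} (hα : α ∈ Set.Ioo (0 : ℝ) 1) :
    discreteTauberian n α < ⊤ := by
  obtain ⟨η, h, h', rfl⟩ := exists_one_sub_pow_eq hn hα.1 hα.2
  exact ((haloBound_one_sub_pow h h').discreteTauberian_le hα.1.le).trans_lt ENNReal.ofReal_lt_top

theorem HaloBound.mono {n : ℕ} {α β C : ℝ} (h : α ≤ β) (hα : HaloBound n α C) :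
    HaloBound n β C :=
  fun E G hG => hα E G fun x hx => halo_mono h E (hG x hx)

/-- Submultiplicativity of the Tauberian constants: passing from level `α` to the level `β > α`
costs at most a halo at a level close to `1`. -/
theorem HaloBound.mul {n : ℕ} (hn : n ≠ 0) {α β ε A B : ℝ} (hα : 0 < α) (hαβ : α < β)
    (hβ : β < 1) (hε : 0 < ε) (hε1 : ε < 1) (hgap : 2 * n * (β - α) ≤ ε * (α * (1 - β)))
    (hB0 : 0 ≤ B) (hA : HaloBound n (1 - ε) A) (hB : HaloBound n β B) :
    HaloBound n α (A * B) := by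
  intro E H hH
  -- Then 1/N ≤ ε/2, so the end-point loss costs at most half of ε. The factor Nⁿ cancels at the
  -- end.
  obtain ⟨N, hN⟩ := exists_nat_gt (2 / ε)
  have hNr : (0 : ℝ) < N := lt_trans (by positivity) hN
  have hN0 : 0 < N := by exact_mod_cast hNr
  have hεN : (1 - ε) * (1 + 1 / (N : ℝ)) ≤ 1 - ε / 2 := by
    have h1 : 1 / (N : ℝ) ≤ ε / 2 := by
      rw [div_lt_iff₀ hε] at hN
      rw [div_le_iff₀ hNr]
      linarith
    have h2 : 0 < 1 / (N : ℝ) := by positivity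
    nlinarith
  have hfin := halo_finite hn (α := 1 - ε) (by linarith) (by linarith) (dilate N E)
  set F := hfin.toFinset with hF
  have hFmem : ∀ x, x ∈ F ↔ x ∈ halo (1 - ε) (dilate N E) := fun x => hfin.mem_toFinset
  have h1 := hB F (dilate N H)
    (dilate_subset_halo_halo hN0 hα hαβ hβ hε hε1 hεN hgap E F H hFmem hH)
  have h2 := hA (dilate N E) F fun x hx => (hFmem x).1 hx
  rw [card_dilate hN0] at h1 h2
  push_cast at h1 h2
  have hNn : (0 : ℝ) < (N : ℝ) ^ n := by positivity
  refine le_of_mul_le_mul_left ?_ hNn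
  calc (N : ℝ) ^ n * H.card ≤ B * F.card := h1
    _ ≤ B * (A * (N ^ n * E.card)) := by gcongr
    _ = _ := by ring

/-- The range x ≤ 2 suffices for the use at x = 4η with η ≤ 1/2. -/
theorem exists_one_add_pow_le (n : ℕ) :
    ∃ D : ℝ, 0 ≤ D ∧ ∀ x : ℝ, 0 ≤ x → x ≤ 2 → (1 + x) ^ n ≤ 1 + D * x := by
  induction n with
  | zero => exact ⟨0, le_rfl, fun x _ _ => by simp⟩
  | succ n ih =>
    obtain ⟨D, hD, h⟩ := ih
    refine ⟨3 * D + 1, by linarith, fun x hx hx2 => ?_⟩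
    calc (1 + x) ^ (n + 1) = (1 + x) ^ n * (1 + x) := pow_succ _ _
      _ ≤ (1 + D * x) * (1 + x) := by gcongr; exact h x hx hx2
      _ ≤ 1 + (3 * D + 1) * x := by nlinarith [mul_nonneg hD hx]

/-- Local Hölder estimate for the Tauberian constant. -/
theorem exists_toReal_discreteTauberian_sub_le {n : ℕ} (hn : n ≠ 0) {a b : ℝ} (ha : 0 < a)
    (hb : b < 1) : ∃ C : ℝ, 0 ≤ C ∧ ∀ α β : ℝ, a ≤ α → α < β → β ≤ b →
      |(discreteTauberian n α).toReal - (discreteTauberian n β).toReal| ≤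
        C * (β - α) ^ (1 / (n : ℝ)) := by
  rcases lt_or_ge b a with hba | hab
  · exact ⟨0, le_rfl, fun α β h1 h2 h3 => by linarith⟩
  obtain ⟨D, hD, hpow⟩ := exists_one_add_pow_le n
  -- Chosen so that ε = κ(β - α) meets the gap condition of `HaloBound.mul` uniformly on [a, b].
  set κ : ℝ := 2 * n / (a * (1 - b)) with hκ
  have hab0 : 0 < a * (1 - b) := mul_pos ha (by linarith)
  have hκ0 : 0 < κ := by positivity
  set c : ℝ → ℝ := fun α => (discreteTauberian n α).toReal with hc
  have hc0 : ∀ α, 0 ≤ c α := fun _ => ENNReal.toReal_nonneg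
  have hbound : ∀ α, a ≤ α → α ≤ b → HaloBound n α (c α) := fun α h1 h2 =>
    haloBound_toReal_discreteTauberian (by linarith)
      (discreteTauberian_lt_top hn ⟨by linarith, by linarith⟩)
  have hcle : ∀ α C, 0 < α → 0 ≤ C → HaloBound n α C → c α ≤ C := fun α C hα hC h =>
    ENNReal.toReal_le_of_le_ofReal hC (h.discreteTauberian_le hα.le)
  have hmono : ∀ α β, a ≤ α → α ≤ β → β ≤ b → c β ≤ c α := fun α β h1 h2 h3 =>
    hcle β _ (by linarith) (hc0 α) ((hbound α h1 (h2.trans h3)).mono h2)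
  refine ⟨(4 * D + 2) * c a * κ ^ (1 / (n : ℝ)), by have := hc0 a; positivity,
    fun α β h1 h2 h3 => ?_⟩
  change |c α - c β| ≤ _
  rw [abs_of_nonneg (sub_nonneg.2 (hmono α β h1 h2.le h3))]
  have hδ : 0 < β - α := by linarith
  rw [mul_assoc, ← Real.mul_rpow hκ0.le hδ.le]
  set η : ℝ := (κ * (β - α)) ^ (1 / (n : ℝ)) with hη
  have hη0 : 0 < η := by positivity
  have hca : c α ≤ c a := hmono a α le_rfl h1 (by linarith)
  have hcb : c β ≤ c a := hmono a β le_rfl (by linarith) h3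
  have hca0 := hc0 a
  have hcb0 := hc0 β
  rcases le_or_gt η (1 / 2) with hη2 | hη2
  · have hηn : η ^ n = κ * (β - α) := by
      rw [hη, one_div, Real.rpow_inv_natCast_pow (by positivity) hn]
    have hle : 2 / (1 - η) - 1 ≤ 1 + 4 * η := by
      rw [div_sub_one (by linarith), div_le_iff₀ (by linarith)]
      nlinarith
    have hge : 0 ≤ 2 / (1 - η) - 1 := by
      rw [div_sub_one (by linarith)]
      exact div_nonneg (by linarith) (by linarith)
    have hA : (2 / (1 - η) - 1) ^ n ≤ 1 + D * (4 * η) :=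
      (pow_le_pow_left₀ hge hle n).trans (hpow _ (by linarith) (by linarith))
    have hgap : 2 * n * (β - α) ≤ η ^ n * (α * (1 - β)) := by
      have h4 : a * (1 - b) ≤ α * (1 - β) :=
        mul_le_mul h1 (by linarith) (by linarith) (by linarith)
      calc 2 * n * (β - α) = κ * (β - α) * (a * (1 - b)) := by
            rw [hκ, div_mul_eq_mul_div, div_mul_cancel₀ _ hab0.ne']
        _ ≤ _ := by rw [hηn]; gcongr
    have h5 := HaloBound.mul hn (by linarith) h2 (by linarith) (pow_pos hη0 n)
      (pow_lt_one₀ hη0.le (by linarith) hn) hgap hcb0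
      (haloBound_one_sub_pow hη0 (by linarith)) (hbound β (by linarith) h3)
    have h6 := hcle α _ (by linarith) (mul_nonneg (pow_nonneg hge n) hcb0) h5
    have h7 : (2 / (1 - η) - 1) ^ n * c β ≤ (1 + D * (4 * η)) * c β := by gcongr
    have h8 : D * (4 * η) * c β ≤ D * (4 * η) * c a := by gcongr
    nlinarith [mul_nonneg hca0 hη0.le]
  -- For η > 1/2 the trivial bound c α ≤ c a ≤ 2η c a suffices; it accounts for the 2 in 4D + 2.
  · have h4 : 0 ≤ D * c a * η := by positivity
    nlinarith

theorem memHolderClass_discreteTauberian {n : ℕ} (hn : n ≠ 0) :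
    MemHolderClass (1 / (n : ℝ≥0)) (fun α => (discreteTauberian n α).toReal)
      (Set.Ioo (0 : ℝ) 1) := by
  intro K hK hKU
  rcases K.eq_empty_or_nonempty with rfl | hne
  · exact ⟨0, fun x hx => absurd hx (Set.notMem_empty x)⟩
  obtain ⟨a, haK, ha⟩ := hK.exists_isLeast hne
  obtain ⟨b, hbK, hb⟩ := hK.exists_isGreatest hne
  obtain ⟨C, hC, h⟩ := exists_toReal_discreteTauberian_sub_le hn (hKU haK).1 (hKU hbK).2
  refine ⟨C.toNNReal, fun x hx y hy => ?_⟩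
  have key : |(discreteTauberian n x).toReal - (discreteTauberian n y).toReal| ≤
      C * |x - y| ^ (1 / (n : ℝ)) := by
    rcases lt_trichotomy x y with hxy | rfl | hxy
    · rw [abs_sub_comm x y, abs_of_pos (sub_pos.2 hxy)]
      exact h x y (ha hx) hxy (hb hy)
    · simp only [sub_self, abs_zero]
      positivity
    · rw [abs_sub_comm (discreteTauberian n x).toReal, abs_of_pos (sub_pos.2 hxy)]
      exact h y x (ha hy) hxy (hb hx)
  rw [edist_dist, edist_dist, Real.dist_eq, Real.dist_eq,
    ENNReal.ofReal_rpow_of_nonneg (abs_nonneg _) (NNReal.coe_nonneg _)]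
  change _ ≤ ENNReal.ofReal C * _
  rw [← ENNReal.ofReal_mul hC]
  refine ENNReal.ofReal_le_ofReal ?_
  push_cast
  exact key

/-! ### The exact constant in dimension one -/

/-- Test on [0, N). Intervals of length k < N/α containing it have density above α and together
cover [N - k, k), of length 2k - N ≥ (2/α - 1)N - 2. Let N grow. -/
theorem le_of_haloBound_one {α C : ℝ} (h0 : 0 < α) (h1 : α < 1) (h : HaloBound 1 α C) :
    2 / α - 1 ≤ C := by
  have hN : ∀ N : ℕ, 0 < N → (2 / α - 1 - C) * N ≤ 2 := by
    intro N hN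
    have hNr : (0 : ℝ) < N := by exact_mod_cast hN
    -- The largest integer strictly below N/α, since the density must exceed α strictly.
    set k : ℤ := ⌈(N : ℝ) / α⌉ - 1 with hk
    have hk1 : (k : ℝ) < N / α := by
      have := Int.ceil_lt_add_one ((N : ℝ) / α)
      rw [hk]; push_cast; linarith
    have hk2 : (N : ℝ) / α - 1 ≤ k := by
      have := Int.le_ceil ((N : ℝ) / α)
      rw [hk]; push_cast; linarith
    have hkN : (N : ℤ) ≤ k := by
      rw [hk]
      have : (N : ℤ) < ⌈(N : ℝ) / α⌉ := by
        rw [Int.lt_ceil]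
        push_cast
        rw [lt_div_iff₀ h0]
        nlinarith
      omega
    have hc := h (box (fun _ => 0) (fun _ => N)) (box (fun _ => N - k) (fun _ => k)) ?_
    · simp only [box, Fintype.card_piFinset, Finset.univ_unique, Finset.prod_singleton,
        Int.card_Ico, sub_zero, Int.toNat_natCast] at hc
      have h2 : (((k - (N - k)).toNat : ℕ) : ℝ) = 2 * k - N := by
        rw [← Int.cast_natCast, Int.toNat_of_nonneg (by omega)]
        push_cast; ring
      rw [h2] at hc
      have : (2 / α - 1 - C) * N = 2 * (N / α) - N - C * N := by ring
      rw [this]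
      linarith
    · intro x hx
      rw [mem_box] at hx
      have hx0 := hx 0
      -- The leftmost start for which an interval of length k contains x and reaches the end of [0,
      -- N); it is at most 0 because N ≤ k and x < k.
      set u : ℤ := max (N - k) (x 0 - k + 1) with hu
      refine ⟨fun _ => u, fun _ => u + k, mem_box.2 fun i => ?_, ?_⟩
      · rw [Subsingleton.elim i 0]
        omega
      · rw [Finset.inter_eq_left.2]
        · simp only [box, Fintype.card_piFinset, Finset.univ_unique, Finset.prod_singleton,
            Int.card_Ico, sub_zero, Int.toNat_natCast, add_sub_cancel_left]
          rw [← Int.cast_natCast k.toNat, Int.toNat_of_nonneg (by omega), mul_comm]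
          exact (lt_div_iff₀ h0).1 hk1
        · intro y hy
          rw [mem_box] at hy ⊢
          intro i
          have := hy i
          omega
  by_contra hcon
  push Not at hcon
  have hpos : 0 < 2 / α - 1 - C := by linarith
  obtain ⟨N, hN'⟩ := exists_nat_gt (2 / (2 / α - 1 - C))
  have hN0 : (0 : ℝ) < N := lt_trans (by positivity) hN'
  have := hN N (by exact_mod_cast hN0)
  rw [div_lt_iff₀ hpos] at hN'
  linarith

theorem discreteTauberian_one {α : ℝ} (hα : α ∈ Set.Ioo (0 : ℝ) 1) :
    discreteTauberian 1 α = ENNReal.ofReal (2 / α - 1) := by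
  apply le_antisymm
  · have := haloBound_one_sub_pow (n := 1) (η := 1 - α) (by linarith [hα.2]) (by linarith [hα.1])
    simp only [pow_one, sub_sub_cancel] at this
    exact this.discreteTauberian_le hα.1.le
  · have hfin := discreteTauberian_lt_top one_ne_zero hα
    rw [ENNReal.ofReal_le_iff_le_toReal hfin.ne]
    exact le_of_haloBound_one hα.1 hα.2 (haloBound_toReal_discreteTauberian hα.1 hfin)

end StrongMaximal

theorem corollaryc :
    (∀ n : ℕ, 2 ≤ n →
      (∀ α ∈ Set.Ioo (0 : ℝ) 1, StrongMaximal.discreteTauberian n α < ⊤) ∧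
      StrongMaximal.MemHolderClass (1 / (n : ℝ≥0))
        (fun α => (StrongMaximal.discreteTauberian n α).toReal) (Set.Ioo (0 : ℝ) 1)) ∧
    ((∀ α ∈ Set.Ioo (0 : ℝ) 1,
        StrongMaximal.discreteTauberian 1 α = ENNReal.ofReal (2 / α - 1)) ∧
      ContDiffOn ℝ ∞ (fun α => (StrongMaximal.discreteTauberian 1 α).toReal)
        (Set.Ioo (0 : ℝ) 1)) := by
  refine ⟨fun n hn => ⟨fun α hα => StrongMaximal.discreteTauberian_lt_top (by omega) hα,
    StrongMaximal.memHolderClass_discreteTauberian (by omega)⟩,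
    fun α hα => StrongMaximal.discreteTauberian_one hα, ?_⟩
  have h : ContDiffOn ℝ ∞ (fun α : ℝ => 2 / α - 1) (Set.Ioo (0 : ℝ) 1) :=
    (contDiffOn_const.div contDiffOn_id fun x hx => hx.1.ne').sub contDiffOn_const
  refine h.congr fun α hα => ?_
  rw [StrongMaximal.discreteTauberian_one hα, ENNReal.toReal_ofReal]
  rw [sub_nonneg, one_le_div hα.1]
  linarith [hα.2]
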